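/- Let $\mathbb{Q}^+$ be the set of positive rational numbers. A first-order theory $T$ is called finitely axiomatizable if some finite set of sentences of its language has exactly the same logical consequences as $T$. Let $\mathsf{TQ}$ be the theory, in the language $\{<,\times,{}^{-1},\mathbf 1\}$, with the following axioms. * $O_1$: $\forall x,y\,(x<y\to y\not<x)$; $O_2$: $\forall x,y,z\,(x<y<z\to x<z)$; $O_3$: $\forall x,y\,(x<y\vee x=y\vee y<x)$. * $M_1$: $\forall x,y,z\,(x\cdot(y\cdot z)=(x\cdot y)\cdot z)$; $M_2$: $\forall x\,(x\cdot\mathbf 1=x)$; $M_3$: $\forall x\,(x\cdot x^{-1}=\mathbf 1)$; $M_4$: $\forall x,y\,(x\cdot y=y\cdot x)$; $M_5$: $\forall x,y,z\,(x<y\to x\cdot z<y\cdot z)$; $M_6$: $\exists y\,(y\ne\mathbf 1)$. * $M_{10}$ (one axiom for each $n\ge1$): $\forall x,z\,\exists y\,(x<z\to x<y^n<z)$. * $M_{11}$ (one axiom for each $n\ge1$, $q\ge0$ and integers $m_0,\dots,m_{q-1}>1$): $\forall x_0,\dots,x_{q-1}\,\exists y\,\forall z\,\bigwedge_{j<q,\;m_j\nmid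 n}\bigl(y^n\cdot x_j\ne z^{m_j}\bigr)$. For a prime $p$ let $\mathbb{Z}[1/p]=\{m/p^k : m\in\mathbb{Z},\,k\in\mathbb{N}\}$, let $\rho_0=2,\rho_1=3,\rho_2=5,\dots$ be the sequence of all primes, and let $$G_p=\Bigl\{\prod_{i<\ell}\rho_i^{r_i} : \ell\in\mathbb{N},\ r_i\in\mathbb{Z}[1/p]\Bigr\}\subset\mathbb{R}^+,$$ with the order, multiplication, inverse and unit of $\mathbb{R}^+$. Then the following hold. 1. The first-order theory of $\langle\mathbb{Q}^+;<,\times\rangle$ is not finitely axiomatizable, and neither is that of $\langle\mathbb{Q}^+;<,\times,{}^{-1},\mathbf 1\rangle$. 2. For every prime $p$, the structure $G_p$ satisfies $O_1$, $O_2$, $O_3$, $M_1,\dots,M_6$, every instance of $M_{10}$, and every instance of $M_{11}$ in which $1<m_j<p$ for all $j<q$; but it does not satisfy the instance of $M_{11}$ with $n=q=1$ and $m_0=p$. 3. For every finite set $F$ of axioms of $\mathsf{TQ}$ and all sufficiently large primes $p$, the structure $G_p$ satisfies every sentence of $F$ but does not satisfy $\mathsf{TQ}$. 4. For every finite set $F$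 of instances of $M_{11}$ there is an instance of $M_{11}$ that is not a logical consequence of $F$ together with the axioms of $\mathsf{TQ}$ other than $M_{11}$. -/

import Mathlib

open FirstOrder FirstOrder.Language

namespace OrdMul

/-! ### The languages -/

/-- The only relation symbol is the binary `<`. -/
inductive Rel : ℕ → Type
  | lt : Rel 2

/-- The function symbol `×`. -/
inductive Func : ℕ → Type
  | mul : Func 2

/-- The function symbols `×`, `⁻¹` and `1`. -/
inductive FuncInv : ℕ → Type
  | mul : FuncInv 2
  | inv : FuncInv 1
  | one : FuncInv 0

/-- The language `{<, ×}`. -/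
abbrev LMul : FirstOrder.Language.{0, 0} := ⟨Func, Rel⟩

/-- The language `{<, ×, ⁻¹, 1}`. -/
abbrev LInv : FirstOrder.Language.{0, 0} := ⟨FuncInv, Rel⟩

/-- `⟨G; <, ×⟩` -/
@[reducible] def structMul (G : Type) [Mul G] [LT G] : LMul.Structure G where
  funMap := fun {n} f => match n, f with
    | _, Func.mul => fun v => v 0 * v 1
  RelMap := fun {n} R => match n, R with
    | _, Rel.lt => fun v => v 0 < v 1

/-- `⟨G; <, ×, ⁻¹, 1⟩` -/
@[reducible] def structInv (G : Type) [Mul G] [Inv G] [One G] [LT G] : LInv.Structure G where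
  funMap := fun {n} f => match n, f with
    | _, FuncInv.mul => fun v => v 0 * v 1
    | _, FuncInv.inv => fun v => (v 0)⁻¹
    | _, FuncInv.one => fun _ => 1
  RelMap := fun {n} R => match n, R with
    | _, Rel.lt => fun v => v 0 < v 1

/-! ### Finite axiomatizability -/

/-- Some finite set of sentences has the same consequences as `T`. -/
def FinitelyAxiomatizable {L : FirstOrder.Language.{0, 0}} (T : L.Theory) : Prop :=
  ∃ F : L.Theory, F.Finite ∧ ∀ φ : L.Sentence, F ⊨ᵇ φ ↔ T ⊨ᵇ φ

/-! ### The axioms of `TQ`, as sentences of `LInv`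

In a formula with `k` free variables, these are `x 0, …, x (k - 1)`, and each quantifier binds
the variable with the largest index. -/

/-- Terms in the `k` variables `x 0, …, x (k - 1)`. -/
abbrev Tm (k : ℕ) : Type := LInv.Term (Empty ⊕ Fin k)

/-- Formulas in the `k` variables `x 0, …, x (k - 1)`. -/
abbrev Fm (k : ℕ) : Type := LInv.BoundedFormula Empty k

/-- The `i`-th variable. -/
def x {k : ℕ} (i : Fin k) : Tm k := Term.var (Sum.inr i)

/-- The term `1`. -/
def one {k : ℕ} : Tm k := Term.func (FuncInv.one : LInv.Functions 0) ![]

/-- The term `s · t`. -/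
def mul {k : ℕ} (s t : Tm k) : Tm k := Term.func (FuncInv.mul : LInv.Functions 2) ![s, t]

/-- The term `t⁻¹`. -/
def inv {k : ℕ} (t : Tm k) : Tm k := Term.func (FuncInv.inv : LInv.Functions 1) ![t]

/-- The term `tⁿ = t · ⋯ · t` (`n` times). -/
def pow {k : ℕ} (t : Tm k) : ℕ → Tm k
  | 0 => one
  | 1 => t
  | n + 2 => mul (pow t (n + 1)) t

/-- The formula `s < t`. -/
def lt {k : ℕ} (s t : Tm k) : Fm k := Relations.boundedFormula₂ (Rel.lt : LInv.Relations 2) s t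

/-- The formula `s = t`. -/
def eq {k : ℕ} (s t : Tm k) : Fm k := Term.bdEqual s t

/-- `∀ x y, x < y → ¬ y < x` -/
def O1 : LInv.Sentence :=
  BoundedFormula.all <| BoundedFormula.all (n := 1) <|
    (lt (x 0) (x 1)).imp (lt (x 1) (x 0)).not

/-- `∀ x y z, x < y ∧ y < z → x < z` -/
def O2 : LInv.Sentence :=
  BoundedFormula.all <| BoundedFormula.all (n := 1) <| BoundedFormula.all (n := 2) <|
    (lt (x 0) (x 1) ⊓ lt (x 1) (x 2)).imp (lt (x 0) (x 2))

/-- `∀ x y, x < y ∨ x = y ∨ y < x` -/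
def O3 : LInv.Sentence :=
  BoundedFormula.all <| BoundedFormula.all (n := 1) <|
    lt (x 0) (x 1) ⊔ (eq (x 0) (x 1) ⊔ lt (x 1) (x 0))

/-- `∀ x y z, x · (y · z) = (x · y) · z` -/
def M1 : LInv.Sentence :=
  BoundedFormula.all <| BoundedFormula.all (n := 1) <| BoundedFormula.all (n := 2) <|
    eq (mul (x 0) (mul (x 1) (x 2))) (mul (mul (x 0) (x 1)) (x 2))

/-- `∀ x, x · 1 = x` -/
def M2 : LInv.Sentence :=
  BoundedFormula.all <| eq (mul (x 0) one) (x 0)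

/-- `∀ x, x · x⁻¹ = 1` -/
def M3 : LInv.Sentence :=
  BoundedFormula.all <| eq (mul (x 0) (inv (x 0))) one

/-- `∀ x y, x · y = y · x` -/
def M4 : LInv.Sentence :=
  BoundedFormula.all <| BoundedFormula.all (n := 1) <|
    eq (mul (x 0) (x 1)) (mul (x 1) (x 0))

/-- `∀ x y z, x < y → x · z < y · z` -/
def M5 : LInv.Sentence :=
  BoundedFormula.all <| BoundedFormula.all (n := 1) <| BoundedFormula.all (n := 2) <|
    (lt (x 0) (x 1)).imp (lt (mul (x 0) (x 2)) (mul (x 1) (x 2)))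

/-- `∃ y, y ≠ 1` -/
def M6 : LInv.Sentence :=
  BoundedFormula.ex <| (eq (x 0) one).not

/-- `∀ x z, ∃ y, x < z → x < yⁿ ∧ yⁿ < z` -/
def M10 (n : ℕ) : LInv.Sentence :=
  BoundedFormula.all <| BoundedFormula.all (n := 1) <| BoundedFormula.ex (n := 2) <|
    (lt (x 0) (x 1)).imp (lt (x 0) (pow (x 2) n) ⊓ lt (pow (x 2) n) (x 1))

/-- `∀ x₀ … x_{q-1}, ∃ y, ∀ z, ⋀_{j < q, m_j ∤ n} yⁿ · x_j ≠ z ^ m_j`; here `y` is the variable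
number `q` and `z` is the variable number `q + 1`. -/
noncomputable def M11 (n : ℕ) {q : ℕ} (m : Fin q → ℕ) : LInv.Sentence :=
  BoundedFormula.alls <| BoundedFormula.ex (n := q) <| BoundedFormula.all (n := q + 1) <|
    BoundedFormula.iInf fun j : {j : Fin q // ¬ m j ∣ n} =>
      (eq (mul (pow (x (Fin.last q).castSucc) n) (x j.1.castSucc.castSucc))
        (pow (x (Fin.last (q + 1))) (m j.1))).not

/-- The axioms of `TQ` other than the instances of `M11`. -/
def TQRest : LInv.Theory :=
  {O1, O2, O3, M1, M2, M3, M4, M5, M6} ∪ {φ | ∃ n : ℕ, 1 ≤ n ∧ φ = M10 n}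

/-- All instances of `M11`. -/
def M11Scheme : LInv.Theory :=
  {φ | ∃ (n q : ℕ) (m : Fin q → ℕ), 1 ≤ n ∧ (∀ j, 1 < m j) ∧ φ = M11 n m}

/-- The theory `TQ`. -/
def TQ : LInv.Theory := TQRest ∪ M11Scheme

/-! ### The structures -/

/-- The positive rational numbers, with Mathlib's multiplication, inverse and order. -/
abbrev PosRat : Type := {r : ℚ // 0 < r}

/-- The positive real numbers, with Mathlib's multiplication, inverse and order. -/
abbrev PosReal : Type := {r : ℝ // 0 < r}

instance : LMul.Structure PosRat := structMul PosRat

instance : LInv.Structure PosRat := structInv PosRat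

/-- `ℤ[1/p] = {m / p ^ k | m ∈ ℤ, k ∈ ℕ}` -/
def zInv (p : ℕ) : Set ℚ := {r | ∃ (m : ℤ) (k : ℕ), r = m / (p : ℚ) ^ k}

theorem zInv_zero (p : ℕ) : (0 : ℚ) ∈ zInv p := ⟨0, 0, by simp⟩

theorem zInv_neg {p : ℕ} {r : ℚ} (hr : r ∈ zInv p) : -r ∈ zInv p := by
  obtain ⟨m, k, rfl⟩ := hr
  exact ⟨-m, k, by push_cast; ring⟩

theorem zInv_add {p : ℕ} [hp : Fact p.Prime] {r s : ℚ} (hr : r ∈ zInv p) (hs : s ∈ zInv p) :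
    r + s ∈ zInv p := by
  obtain ⟨m, k, rfl⟩ := hr
  obtain ⟨m', k', rfl⟩ := hs
  have h : (p : ℚ) ≠ 0 := by exact_mod_cast hp.out.ne_zero
  refine ⟨m * p ^ k' + m' * p ^ k, k + k', ?_⟩
  push_cast
  field_simp
  ring

/-- `∏_{i < l} ρ_i ^ r_i`, where `ρ_0 = 2, ρ_1 = 3, ρ_2 = 5, …` are the prime numbers. -/
noncomputable def primeProd (l : ℕ) (r : ℕ → ℚ) : ℝ :=
  ∏ i ∈ Finset.range l, (Nat.nth Nat.Prime i : ℝ) ^ (r i : ℝ)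

theorem prime_pos (i : ℕ) : (0 : ℝ) < (Nat.nth Nat.Prime i : ℝ) :=
  Nat.cast_pos.2 (Nat.prime_nth_prime i).pos

theorem primeProd_extend (l d : ℕ) (r : ℕ → ℚ) :
    primeProd (l + d) (fun i => if i < l then r i else 0) = primeProd l r := by
  unfold primeProd
  rw [Finset.prod_range_add]
  have h : ∏ i ∈ Finset.range d, (Nat.nth Nat.Prime (l + i) : ℝ) ^
      (((if l + i < l then r (l + i) else 0 : ℚ)) : ℝ) = 1 :=
    Finset.prod_eq_one fun i _ => by simp
  rw [h, mul_one]
  exact Finset.prod_congr rfl fun i hi => by simp [Finset.mem_range.1 hi]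

/-- The group `{∏_{i < l} ρ_i ^ r_i | l ∈ ℕ, r_i ∈ ℤ[1/p]}` of positive real numbers. -/
noncomputable def primeRoots (p : ℕ) [Fact p.Prime] : Subgroup PosReal where
  carrier := {a | ∃ (l : ℕ) (r : ℕ → ℚ), (∀ i, r i ∈ zInv p) ∧ (a : ℝ) = primeProd l r}
  one_mem' := ⟨0, fun _ => 0, fun _ => zInv_zero p, by simp [primeProd]⟩
  mul_mem' := by
    rintro a b ⟨l, r, hr, ha⟩ ⟨l', r', hr', hb⟩
    refine ⟨l + l', fun i => (if i < l then r i else 0) + (if i < l' then r' i else 0),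
      fun i => ?_, ?_⟩
    · apply zInv_add <;> split_ifs <;> first | exact zInv_zero p | exact hr i | exact hr' i
    · have h' := primeProd_extend l' l r'
      rw [add_comm l' l] at h'
      rw [Positive.val_mul, ha, hb, ← primeProd_extend l l' r, ← h']
      simp only [primeProd, ← Finset.prod_mul_distrib]
      refine Finset.prod_congr rfl fun i _ => ?_
      rw [Rat.cast_add, Real.rpow_add (prime_pos i)]
  inv_mem' := by
    rintro a ⟨l, r, hr, ha⟩
    refine ⟨l, fun i => -r i, fun i => zInv_neg (hr i), ?_⟩
    rw [Positive.coe_inv, ha]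
    simp only [primeProd, ← Finset.prod_inv_distrib]
    refine Finset.prod_congr rfl fun i _ => ?_
    rw [Rat.cast_neg, Real.rpow_neg (prime_pos i).le]

noncomputable instance (p : ℕ) [Fact p.Prime] : LInv.Structure (primeRoots p) :=
  structInv (primeRoots p)

end OrdMul

/-! Every sentence true in ℚ⁺ holds in G_p for all large primes p, while G_p violates a sentence
true in ℚ⁺: all its elements are p-th powers. A finite set with the consequences of Th(ℚ⁺) would
hold in some G_p, hence so would all of Th(ℚ⁺), a contradiction (`not_finitelyAxiomatizable`).

The transfer (`exists_realize_iff`) is an Ehrenfeucht–Fraïssé argument in ordered abelian groups,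
written additively. Two tuples are similar up to N if their integer combinations with coefficients
up to N have the same signs and the same divisibility by moduli up to N. `Sim.exists_snoc` answers
each new element, at the price of a larger N. An element dependent on the old ones has a forced
answer. Otherwise its congruences are matched by `exists_same_congruences`, where the group must not
be covered by finitely many cosets of proper subgroups of multiples, and its inequalities are
matched by density of multiples. These two properties and nontriviality form `Rich`.

Both ℚ⁺ and G_p have them, the latter for moduli below p. Density in ℚ⁺ comes from rational powers
between rationals, and in G_p from high p-power roots of 2. Coset avoidance is M11 with n = 1, and
M11 follows from a q-adic valuation at a prime q absent from the given elements
(`exists_prime_pow_mul_ne`). For finite subsets of TQ this direct check of the axioms suffices,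
without the transfer. -/

namespace OrdMul

/-! ### Divisibility in torsion-free abelian groups and extension of congruences -/

/-- The elements of an abelian group that are divisible by `m`. -/
def multiples (A : Type*) [AddCommGroup A] (m : ℤ) : Submodule ℤ A :=
  LinearMap.range (LinearMap.lsmul ℤ A m)

theorem mem_multiples {A : Type*} [AddCommGroup A] {m : ℤ} {a : A} :
    a ∈ multiples A m ↔ ∃ z, m • z = a := Iff.rfl

theorem smul_mem_multiples {A : Type*} [AddCommGroup A] (m : ℤ) (a : A) :
    m • a ∈ multiples A m := ⟨a, rfl⟩

theorem multiples_le {A : Type*} [AddCommGroup A] {m n : ℤ} (h : m ∣ n) :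
    multiples A n ≤ multiples A m := by
  rintro _ ⟨z, rfl⟩
  obtain ⟨e, rfl⟩ := h
  exact ⟨e • z, smul_smul m e z⟩

theorem smul_mem_multiples_mul {A : Type*} [AddCommGroup A] [IsAddTorsionFree A] {d m : ℤ}
    (hd : d ≠ 0) {a : A} : d • a ∈ multiples A (d * m) ↔ a ∈ multiples A m := by
  simp only [mem_multiples, mul_smul]
  exact exists_congr fun z => (zsmul_right_injective hd).eq_iff

/-- Finitely many cosets of the subgroups of `m`-multiples, `1 < m ≤ N`, never cover the group. -/
def AvoidsCosets (B : Type*) [AddCommGroup B] (N : ℕ) : Prop :=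
  ∀ s : Finset (ℕ × B), (∀ e ∈ s, 1 < e.1 ∧ e.1 ≤ N) → ∃ w, ∀ e ∈ s, w - e.2 ∉ multiples B e.1

theorem AvoidsCosets.mono {B : Type*} [AddCommGroup B] {M N : ℕ} (h : AvoidsCosets B N)
    (hMN : M ≤ N) : AvoidsCosets B M :=
  fun s hs => h s fun e he => ⟨(hs e he).1, (hs e he).2.trans hMN⟩

/-- The combination `∑ i, c i • a i`. -/
abbrev comb {A : Type*} [AddCommGroup A] {k : ℕ} (a : Fin k → A) : (Fin k → ℤ) →ₗ[ℤ] A :=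
  Fintype.linearCombination ℤ a

theorem comb_emod_sub_mem {A : Type*} [AddCommGroup A] {k : ℕ} (a : Fin k → A) (m : ℤ)
    (c : Fin k → ℤ) : comb a c - comb a (fun i => c i % m) ∈ multiples A m := by
  have : c - (fun i => c i % m) = m • fun i => c i / m := by
    ext i
    have := Int.mul_ediv_add_emod (c i) m
    simp only [Pi.sub_apply, Pi.smul_apply, smul_eq_mul]
    linarith
  rw [← map_sub, this, map_smul]
  exact smul_mem_multiples _ _

/-- Coefficients matter only modulo m, so finitely many coefficient vectors decide all congruences
modulo m. -/
theorem comb_emod_mem_iff {A : Type*} [AddCommGroup A] {k : ℕ} (a : Fin k → A) (m : ℤ)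
    (c : Fin k → ℤ) : comb a (fun i => c i % m) ∈ multiples A m ↔ comb a c ∈ multiples A m := by
  have := comb_emod_sub_mem a m c
  constructor <;> intro h
  · simpa using add_mem this h
  · simpa using sub_mem h this

/-- A condition `M ∣ x + d • w` on `w` that does not hold for trivial reasons confines `w` to a
coset of some proper subgroup of multiples. -/
theorem exists_coset_of_smul {B : Type*} [AddCommGroup B] [IsAddTorsionFree B] {M D₀ E D : ℤ}
    (hM : 0 < M) (hE : M = D₀ * E) (hD : ¬ D₀ ∣ D) (u : B) :
    ∃ e : ℕ × B, (1 < e.1 ∧ e.1 ≤ M.toNat) ∧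
      ∀ w, u + (D * E) • w ∈ multiples B M → w - e.2 ∈ multiples B e.1 := by
  have hE0 : E ≠ 0 := by rintro rfl; simp at hE; omega
  have hD0 : D₀ ≠ 0 := by rintro rfl; simp at hE; omega
  -- If the condition has a solution, x is one and serves as coset representative; otherwise any x
  -- works and 0 is taken.
  obtain ⟨x, hx⟩ : ∃ x : B, (∃ w, u + (D * E) • w ∈ multiples B M) →
      u + (D * E) • x ∈ multiples B M := by
    by_cases h : ∃ w, u + (D * E) • w ∈ multiples B M
    · exact ⟨h.choose, fun _ => h.choose_spec⟩
    · exact ⟨0, fun h' => absurd h' h⟩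
  -- With g = gcd(D, D₀), the modulus of the coset is F = D₀ / g, which is not a unit because D₀
  -- does not divide D.
  obtain ⟨g, hgD, ⟨F, hF⟩, r, s, hrs⟩ : ∃ g, g ∣ D ∧ g ∣ D₀ ∧ ∃ r s, g = D * r + D₀ * s :=
    ⟨_, Int.gcd_dvd_left _ _, Int.gcd_dvd_right _ _, _, _, Int.gcd_eq_gcd_ab _ _⟩
  have hg0 : g ≠ 0 := by rintro rfl; rw [zero_mul] at hF; exact hD0 hF
  refine ⟨(F.natAbs, x), ⟨?_, ?_⟩, fun w hw => ?_⟩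
  · have h0 : F.natAbs ≠ 0 := by
      rw [Int.natAbs_ne_zero]; rintro rfl; simp at hF; exact hD0 hF
    have h1 : F.natAbs ≠ 1 := fun h =>
      hD (hF ▸ ((Int.isUnit_iff_natAbs_eq.2 h).mul_right_dvd.2 hgD))
    change 1 < F.natAbs
    omega
  · have := Int.natAbs_le_of_dvd_ne_zero (m := F) (n := M) ⟨g * E, by rw [hE]; nth_rw 1 [hF]; ring⟩ hM.ne'
    change F.natAbs ≤ M.toNat
    omega
  · have h1 := sub_mem hw (hx ⟨w, hw⟩)
    rw [add_sub_add_left_eq_sub, ← smul_sub, hE, mul_comm D, mul_comm D₀, mul_smul,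
      smul_mem_multiples_mul hE0] at h1
    have h2 : g • (w - x) ∈ multiples B D₀ := by
      rw [hrs, add_smul, mul_comm D, mul_smul, mul_smul]
      exact add_mem (Submodule.smul_mem _ _ h1) (smul_mem_multiples _ _)
    rw [hF, smul_mem_multiples_mul hg0] at h2
    exact multiples_le (Int.natAbs_dvd.2 dvd_rfl) h2

/-- Subtracting e times the known relation eliminates the new element. -/
theorem comb_add_smul_mem_iff {A : Type*} [AddCommGroup A] {k : ℕ} {a : Fin k → A} {a' : A}
    {M D : ℤ} {c₀ : Fin k → ℤ} (h : comb a c₀ + D • a' ∈ multiples A M) {c : Fin k → ℤ} {e : ℤ} :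
    comb a c + (D * e) • a' ∈ multiples A M ↔ comb a (c - e • c₀) ∈ multiples A M := by
  have h2 : comb a c + (D * e) • a' = comb a (c - e • c₀) + e • (comb a c₀ + D • a') := by
    rw [map_sub, map_smul, smul_add, smul_smul, mul_comm e]; abel
  rw [h2, Submodule.add_mem_iff_left _ (Submodule.smul_mem _ e h)]

/-- Tuples satisfying the same congruences modulo the divisors of `M` can be extended. -/
theorem exists_same_congruences {A B : Type*} [AddCommGroup A] [AddCommGroup B]
    [IsAddTorsionFree B] {k : ℕ} {a : Fin k → A} {b : Fin k → B} {M : ℤ} (hM : 0 < M)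
    (h : ∀ m, m ∣ M → ∀ c, comb a c ∈ multiples A m ↔ comb b c ∈ multiples B m)
    (hB : AvoidsCosets B M.toNat) (a' : A) :
    ∃ b' : B, ∀ (c : Fin k → ℤ) (d : ℤ), comb a c + d • a' ∈ multiples A M ↔ comb b c + d • b' ∈ multiples B M := by
  -- The coefficients that `a'` can have in a congruence modulo M form an ideal; its generator D₀
  -- comes from one relation, with coefficients `c₀`, that yields all the others up to old
  -- congruences.
  let I : Ideal ℤ :=
    { carrier := {d | ∃ c, comb a c + d • a' ∈ multiples A M}
      add_mem' := by
        rintro d d' ⟨c, hc⟩ ⟨c', hc'⟩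
        refine ⟨c + c', ?_⟩
        have := add_mem hc hc'
        rw [map_add, add_smul]
        rwa [add_add_add_comm] at this
      zero_mem' := ⟨0, by simp⟩
      smul_mem' := by
        rintro e d ⟨c, hc⟩
        refine ⟨e • c, ?_⟩
        rw [map_smul, smul_assoc, ← smul_add]
        exact Submodule.smul_mem _ _ hc }
  obtain ⟨D₀, hD₀⟩ : ∃ D₀, ∀ d, d ∈ I ↔ D₀ ∣ d :=
    ⟨_, fun d => Submodule.IsPrincipal.mem_iff_generator_dvd I⟩
  obtain ⟨E, hE⟩ : D₀ ∣ M := (hD₀ M).1 ⟨0, by simpa using smul_mem_multiples M a'⟩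
  have hD0 : D₀ ≠ 0 := by rintro rfl; simp at hE; omega
  obtain ⟨c₀, hc₀⟩ : D₀ ∈ I := (hD₀ D₀).2 dvd_rfl
  -- As D₀ divides M, the relation makes the old part divisible by D₀. This is a congruence on `a`
  -- alone, so it passes to `b`.
  have hdiv : comb a c₀ ∈ multiples A D₀ := by
    have := sub_mem (multiples_le ⟨E, hE⟩ hc₀) (smul_mem_multiples D₀ a')
    simpa using this
  obtain ⟨v, hv⟩ := mem_multiples.1 ((h D₀ ⟨E, hE⟩ c₀).1 hdiv)
  choose! f hf using fun (t : (Fin k → ℤ) × ℤ) (ht : ¬ D₀ ∣ t.2) =>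
    exists_coset_of_smul hM hE ht (comb b t.1 - t.2 • v)
  classical
  -- The answer E • w - v satisfies the basic relation for every w. The freedom in w is used to
  -- refute the congruences with d outside the ideal, finitely many after reduction modulo M.
  obtain ⟨w, hw⟩ := hB ((((Fintype.piFinset fun _ : Fin k => Finset.Ico 0 M) ×ˢ
    Finset.Ico 0 M).filter fun t => ¬ D₀ ∣ t.2).image f) (by
      intro e he
      obtain ⟨t, ht, rfl⟩ := Finset.mem_image.1 he
      exact (hf t (Finset.mem_filter.1 ht).2).1)
  have hb0 : comb b c₀ + D₀ • (E • w - v) = M • w := by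
    rw [← hv, smul_sub, smul_smul, ← hE]; abel
  refine ⟨E • w - v, fun c d => ?_⟩
  by_cases hd : D₀ ∣ d
  · obtain ⟨e, rfl⟩ := hd
    rw [comb_add_smul_mem_iff hc₀, comb_add_smul_mem_iff (hb0 ▸ smul_mem_multiples M w)]
    exact h M dvd_rfl _
  · refine iff_of_false (fun h' => hd ((hD₀ d).1 ⟨c, h'⟩)) fun h' => ?_
    have hd' : ¬ D₀ ∣ d % M := by rwa [Int.emod_def, dvd_sub_left ⟨E * (d / M), by rw [hE]; ring⟩]
    refine hw _ (Finset.mem_image_of_mem f (a := (fun i => c i % M, d % M)) ?_) ((hf _ hd').2 w ?_)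
    · simp [Fintype.mem_piFinset, Int.emod_nonneg _ hM.ne', Int.emod_lt_of_pos _ hM, hd']
    · have h1 := comb_emod_sub_mem b M c
      have h2 : (d - d % M) • (E • w - v) ∈ multiples B M := by
        rw [Int.emod_def, sub_sub_cancel, mul_smul]
        exact smul_mem_multiples _ _
      have h3 := sub_mem (sub_mem h' h1) h2
      convert h3 using 1
      simp only [sub_smul, smul_sub, mul_smul]
      abel

/-! ### Similar tuples and the back-and-forth step -/

/-- `a` and `b` satisfy the same inequalities and congruences with coefficients and moduli up
to `N`. -/
def Sim {A B : Type*} [AddCommGroup A] [LinearOrder A] [AddCommGroup B] [LinearOrder B] (N : ℕ)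
    {k : ℕ} (a : Fin k → A) (b : Fin k → B) : Prop :=
  ∀ c : Fin k → ℤ, (∀ i, |c i| ≤ N) → (0 < comb a c ↔ 0 < comb b c) ∧
    ∀ m : ℕ, 0 < m → m ≤ N → (comb a c ∈ multiples A m ↔ comb b c ∈ multiples B m)

/-- Between any two elements there is a multiple of any nonzero natural number. -/
def DenseMultiples (B : Type*) [AddCommGroup B] [LinearOrder B] : Prop :=
  ∀ n : ℕ, 0 < n → ∀ x z : B, x < z → ∃ y, x < n • y ∧ n • y < z

theorem comb_snoc {A : Type*} [AddCommGroup A] {k : ℕ} (a : Fin k → A) (a' : A) (c : Fin (k + 1) → ℤ) :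
    comb (Fin.snoc a a') c = comb a (fun i => c i.castSucc) + c (Fin.last k) • a' := by
  simp [Fintype.linearCombination_apply, Fin.sum_univ_castSucc]

/-- Scaling by q turns conditions with different coefficients d into bounds on the single element M
• a'. -/
theorem sign_iff_lt_smul {A : Type*} [AddCommGroup A] [LinearOrder A] [IsOrderedAddMonoid A]
    {k : ℕ} (a : Fin k → A) (a' : A) {M d q : ℤ} (hM : M = d * q) (hq : 0 < q)
    (c : Fin k → ℤ) :
    (0 < comb a c + d • a' ↔ comb a (-(q • c)) < M • a') ∧
    (comb a c + d • a' < 0 ↔ M • a' < comb a (-(q • c))) := by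
  rw [← smul_pos_iff_of_pos_left hq, ← smul_neg_iff_of_pos_left hq, map_neg, map_smul, smul_add,
    smul_smul, mul_comm q, ← hM, neg_lt_iff_pos_add', lt_neg_iff_add_neg']
  exact ⟨Iff.rfl, Iff.rfl⟩

section
variable {A B : Type*} [AddCommGroup A] [LinearOrder A]
  [AddCommGroup B] [LinearOrder B] {N : ℕ} {k : ℕ} {a : Fin k → A}
  {b : Fin k → B}

theorem Sim.symm (h : Sim N a b) : Sim N b a :=
  fun c hc => ⟨(h c hc).1.symm, fun m h0 hm => ((h c hc).2 m h0 hm).symm⟩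

theorem Sim.mono {M : ℕ} (h : Sim N a b) (hMN : M ≤ N) : Sim M a b := fun c hc => by
  have := h c fun i => (hc i).trans (by exact_mod_cast hMN)
  exact ⟨this.1, fun m h0 hm => this.2 m h0 (hm.trans hMN)⟩

/-- For congruences the coefficient bound is harmless: coefficients can be reduced modulo m, which
is itself bounded by N. -/
theorem Sim.mem_multiples_iff (h : Sim N a b) {m : ℤ} (hm0 : m ≠ 0) (hm : |m| ≤ N)
    (c : Fin k → ℤ) : comb a c ∈ multiples A m ↔ comb b c ∈ multiples B m := by
  have key : ∀ m : ℕ, 0 < m → m ≤ N →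
      (comb a c ∈ multiples A m ↔ comb b c ∈ multiples B m) := by
    intro m h0 hm
    rw [← comb_emod_mem_iff a, ← comb_emod_mem_iff b]
    refine (h _ fun i => ?_).2 m h0 hm
    have h1 := Int.emod_nonneg (c i) (b := m) (by omega)
    have h2 := Int.emod_lt_of_pos (c i) (b := m) (by omega)
    rw [abs_of_nonneg h1]
    omega
  have hA : multiples A m = multiples A m.natAbs :=
    le_antisymm (multiples_le (Int.natAbs_dvd.2 dvd_rfl)) (multiples_le (Int.dvd_natAbs.2 dvd_rfl))
  have hB : multiples B m = multiples B m.natAbs :=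
    le_antisymm (multiples_le (Int.natAbs_dvd.2 dvd_rfl)) (multiples_le (Int.dvd_natAbs.2 dvd_rfl))
  rw [hA, hB]
  exact key _ (by omega) (by rw [Int.abs_eq_natAbs] at hm; omega)

variable [IsOrderedAddMonoid A] [IsOrderedAddMonoid B]

theorem Sim.neg_iff (h : Sim N a b) {c : Fin k → ℤ} (hc : ∀ i, |c i| ≤ N) :
    comb a c < 0 ↔ comb b c < 0 := by
  have := (h (-c) fun i => by simpa using hc i).1
  simpa using this

theorem Sim.eq_zero_iff (h : Sim N a b) {c : Fin k → ℤ} (hc : ∀ i, |c i| ≤ N) :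
    comb a c = 0 ↔ comb b c = 0 := by
  have h1 := (h c hc).1
  have h2 := h.neg_iff hc
  rw [← not_iff_not, ← ne_eq, ← ne_eq, ne_iff_lt_or_gt, ne_iff_lt_or_gt, h1, h2]

/-- To compare the signs, it is enough to do so for positive coefficients of the new element. -/
theorem sim_snoc_iff_of_pos {a' : A} {b' : B} (h : Sim N a b)
    (hs : ∀ (c : Fin k → ℤ) (d : ℤ), (∀ i, |c i| ≤ N) → 0 < d → d ≤ N →
      (0 < comb a c + d • a' ↔ 0 < comb b c + d • b') ∧
      (comb a c + d • a' < 0 ↔ comb b c + d • b' < 0))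
    (hm : ∀ (c : Fin k → ℤ) (d : ℤ) (m : ℕ), (∀ i, |c i| ≤ N) → |d| ≤ N → 0 < m → m ≤ N →
      (comb a c + d • a' ∈ multiples A m ↔ comb b c + d • b' ∈ multiples B m)) :
    Sim N (Fin.snoc a a' : Fin (k + 1) → A) (Fin.snoc b b' : Fin (k + 1) → B) := by
  intro c hc
  rw [comb_snoc, comb_snoc]
  refine ⟨?_, fun m => hm _ _ m (fun i => hc _) (hc _)⟩
  have hl := hc (Fin.last k)
  rcases lt_trichotomy (c (Fin.last k)) 0 with h0 | h0 | h0
  · have := (hs (-fun i => c i.castSucc) (-c (Fin.last k)) (fun i => by simpa using hc i.castSucc)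
      (by omega) (by rw [abs_of_neg h0] at hl; exact hl)).2
    rw [map_neg, map_neg, neg_smul, neg_smul, ← neg_add, ← neg_add, neg_lt_zero, neg_lt_zero] at this
    exact this
  · simpa [h0] using (h _ fun i => hc i.castSucc).1
  · exact (hs _ _ (fun i => hc i.castSucc) h0 ((le_abs_self _).trans hl)).1

/-- If the new element is a rational combination of the old ones, then so is its counterpart. -/
theorem Sim.exists_snoc_of_eq_zero (h : Sim (2 * N * N) a b) {a' : A} {c₀ : Fin k → ℤ} {D : ℤ}
    (hc₀ : ∀ i, |c₀ i| ≤ N) (hD0 : 0 < D) (hD : D ≤ N) (h0 : comb a c₀ + D • a' = 0) :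
    ∃ b' : B, Sim N (Fin.snoc a a' : Fin (k + 1) → A) (Fin.snoc b b' : Fin (k + 1) → B) := by
  have hN : (1 : ℤ) ≤ N := by omega
  have hNN : N ≤ 2 * N * N := by nlinarith
  obtain ⟨v, hv⟩ : comb b c₀ ∈ multiples B D := by
    rw [← h.mem_multiples_iff hD0.ne']
    · rw [eq_neg_of_add_eq_zero_left h0, ← smul_neg]
      exact smul_mem_multiples _ _
    · rw [abs_of_pos hD0]; push_cast; nlinarith
  change D • v = _ at hv
  -- Multiplying by D eliminates the new element. The resulting coefficients are at most 2N² and the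
  -- moduli D * m at most N², which accounts for the bound in the hypothesis.
  have ea : ∀ (c : Fin k → ℤ) (d : ℤ), D • (comb a c + d • a') = comb a (D • c - d • c₀) := by
    intro c d
    rw [map_sub, map_smul, map_smul, eq_neg_of_add_eq_zero_left h0, smul_add, smul_neg,
      smul_comm d D]
    abel
  have eb : ∀ (c : Fin k → ℤ) (d : ℤ), D • (comb b c + d • (-v)) = comb b (D • c - d • c₀) := by
    intro c d
    rw [map_sub, map_smul, map_smul, ← hv, smul_add, smul_neg, smul_neg, smul_comm d D]
    abel
  have bd : ∀ (c : Fin k → ℤ) (d : ℤ), (∀ i, |c i| ≤ N) → |d| ≤ N → ∀ i,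
      |(D • c - d • c₀) i| ≤ ((2 * N * N : ℕ) : ℤ) := by
    intro c d hc hd i
    have h1 := abs_sub (D * c i) (d * c₀ i)
    rw [abs_mul, abs_mul, abs_of_pos hD0] at h1
    have h2 := mul_le_mul hD (hc i) (abs_nonneg _) (by omega)
    have h3 := mul_le_mul hd (hc₀ i) (abs_nonneg _) (by omega)
    simp only [Pi.sub_apply, Pi.smul_apply, smul_eq_mul]
    push_cast
    linarith
  refine ⟨-v, sim_snoc_iff_of_pos (h.mono hNN) (fun c d hc hd0 hd => ?_)
    fun c d m hc hd hm0 hm => ?_⟩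
  · have hb := bd c d hc (by rwa [abs_of_pos hd0])
    have h1 := (h _ hb).1
    have h2 := h.neg_iff hb
    rw [← ea, ← eb] at h1 h2
    rw [smul_pos_iff_of_pos_left hD0, smul_pos_iff_of_pos_left hD0] at h1
    rw [smul_neg_iff_of_pos_left hD0, smul_neg_iff_of_pos_left hD0] at h2
    exact ⟨h1, h2⟩
  · rw [← smul_mem_multiples_mul hD0.ne', ← smul_mem_multiples_mul (A := B) hD0.ne', ea, eb]
    refine h.mem_multiples_iff (mul_ne_zero hD0.ne' (by omega)) ?_ _
    rw [abs_mul, abs_of_pos hD0, Nat.abs_cast]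
    push_cast
    have : (m : ℤ) ≤ N := by exact_mod_cast hm
    nlinarith

/-- If the new element is not a rational combination of the old ones, then its counterpart is
found by solving finitely many congruences inside an interval. -/
theorem Sim.exists_snoc_of_ne_zero [Nontrivial B] {N' : ℕ} (h : Sim N' a b) (hN : N ≤ N')
    (hN1 : N.factorial ≤ N') (hN2 : 2 * N.factorial * N ≤ N') (hD : DenseMultiples B)
    (hB : AvoidsCosets B N.factorial) {a' : A}
    (hne : ∀ (c : Fin k → ℤ) (d : ℤ), (∀ i, |c i| ≤ N) → 0 < d → d ≤ N →
      comb a c + d • a' ≠ 0) :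
    ∃ b' : B, Sim N (Fin.snoc a a' : Fin (k + 1) → A) (Fin.snoc b b' : Fin (k + 1) → B) := by
  have hM : (0 : ℤ) < N.factorial := by exact_mod_cast N.factorial_pos
  have hdvd : ∀ d : ℤ, 0 < d → d ≤ N → ∃ q, (N.factorial : ℤ) = d * q ∧ 0 < q := by
    intro d h0 hd
    lift d to ℕ using h0.le
    obtain ⟨q, hq⟩ := Nat.dvd_factorial (m := d) (by exact_mod_cast h0) (by exact_mod_cast hd)
    have : q ≠ 0 := by rintro rfl; simp [N.factorial_ne_zero] at hq
    exact ⟨q, by exact_mod_cast hq, by omega⟩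
  have : DenselyOrdered B := ⟨fun x z hxz => by
    obtain ⟨y, h1, h2⟩ := hD 1 one_pos x z hxz
    exact ⟨y, by simpa using h1, by simpa using h2⟩⟩
  -- `b₀` has the right congruences modulo N!, hence modulo every m ≤ N, but perhaps the wrong
  -- position in the order.
  obtain ⟨b₀, hb₀⟩ := exists_same_congruences hM (a := a) (b := b)
    (fun m hm c => h.mem_multiples_iff (by rintro rfl; simp at hm; omega)
      (by
        have := Int.le_of_dvd hM ((abs_dvd _ _).2 hm)
        exact this.trans (by exact_mod_cast hN1)) c) (by simpa using hB) a'
  have hsep : ∃ y₁ y₂ : B, y₁ < y₂ ∧ ∀ (c : Fin k → ℤ) (d q : ℤ), (∀ i, |c i| ≤ N) → 0 < d →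
      d ≤ N → (N.factorial : ℤ) = d * q → 0 < q →
      (0 < comb a c + d • a' → comb b (-(q • c)) < y₁) ∧
      (comb a c + d • a' < 0 → y₂ < comb b (-(q • c))) := by
    classical
    let S := (Fintype.piFinset fun _ : Fin k => Finset.Icc (-N : ℤ) N) ×ˢ Finset.Icc (1 : ℤ) N ×ˢ
      Finset.Icc (1 : ℤ) N.factorial
    let S' := S.filter fun t => (N.factorial : ℤ) = t.2.1 * t.2.2
    let val : (Fin k → ℤ) × ℤ × ℤ → B := fun t => comb b (-(t.2.2 • t.1))
    -- The lower and upper bounds to be imposed on N! times the answer, transported from `a` to `b`.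
    let lo := (S'.filter fun t => 0 < comb a t.1 + t.2.1 • a').image val
    let hi := (S'.filter fun t => comb a t.1 + t.2.1 • a' < 0).image val
    have hlt : ∀ x ∈ lo, ∀ y ∈ hi, x < y := by
      intro x hx y hy
      obtain ⟨⟨c, d, q⟩, ht, rfl⟩ := Finset.mem_image.1 hx
      obtain ⟨⟨c', d', q'⟩, ht', rfl⟩ := Finset.mem_image.1 hy
      simp only [S', S, Finset.mem_filter, Finset.mem_product, Fintype.mem_piFinset,
        Finset.mem_Icc, ← abs_le] at ht ht'
      obtain ⟨⟨⟨hc, hd, hq⟩, hdq⟩, hp⟩ := ht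
      obtain ⟨⟨⟨hc', hd', hq'⟩, hdq'⟩, hp'⟩ := ht'
      have h1 := ((sign_iff_lt_smul a a' hdq (by omega) c).1.1 hp).trans
        ((sign_iff_lt_smul a a' hdq' (by omega) c').2.1 hp')
      have bd : ∀ i, |(-(q' • c') - -(q • c)) i| ≤ (N' : ℤ) := fun i => by
        have h1 := abs_sub (-(q' * c' i)) (-(q * c i))
        rw [abs_neg, abs_neg, abs_mul, abs_mul, abs_of_pos (by omega : 0 < q'),
          abs_of_pos (by omega : 0 < q)] at h1
        have h2 := mul_le_mul hq.2 (hc i) (abs_nonneg _) hM.le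
        have h3 := mul_le_mul hq'.2 (hc' i) (abs_nonneg _) hM.le
        have h4 : (2 * N.factorial * N : ℤ) ≤ N' := by exact_mod_cast hN2
        simp only [Pi.sub_apply, Pi.neg_apply, Pi.smul_apply, smul_eq_mul]
        linarith
      rw [← sub_pos, ← map_sub, (h _ bd).1, map_sub, sub_pos] at h1
      exact h1
    obtain ⟨y₁, h1, h2⟩ := Order.exists_between_finsets lo hi hlt
    obtain ⟨y₂, h3, h4⟩ := Order.exists_between_finsets (insert y₁ lo) hi (by
      intro x hx y hy
      rcases Finset.mem_insert.1 hx with rfl | hx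
      · exact h2 y hy
      · exact hlt x hx y hy)
    refine ⟨y₁, y₂, h3 _ (Finset.mem_insert_self _ _), fun c d q hc hd0 hd hdq hq => ?_⟩
    have hmem : (c, d, q) ∈ S' := by
      simp only [S', S, Finset.mem_filter, Finset.mem_product, Fintype.mem_piFinset,
        Finset.mem_Icc, ← abs_le]
      exact ⟨⟨hc, ⟨hd0, hd⟩, hq, Int.le_of_dvd hM ⟨d, by rw [hdq, mul_comm]⟩⟩, hdq⟩
    exact ⟨fun hp => h1 _ (Finset.mem_image_of_mem val (Finset.mem_filter.2 ⟨hmem, hp⟩)),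
      fun hp => h4 _ (Finset.mem_image_of_mem val (Finset.mem_filter.2 ⟨hmem, hp⟩))⟩
  obtain ⟨y₁, y₂, hy, hsep⟩ := hsep
  -- Adding N! • y to `b₀` keeps its congruences. It moves N! • b₀ by N!² • y, so a multiple of N!²
  -- is sought in the shifted interval.
  obtain ⟨y, hy1, hy2⟩ := hD (N.factorial * N.factorial)
    (Nat.mul_pos N.factorial_pos N.factorial_pos) _ _
    (sub_lt_sub_right hy ((N.factorial : ℤ) • b₀))
  have hb' : (N.factorial : ℤ) • (b₀ + (N.factorial : ℤ) • y) =
      (N.factorial : ℤ) • b₀ + (N.factorial * N.factorial) • y := by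
    rw [smul_add, smul_smul, ← Nat.cast_mul, natCast_zsmul _ (N.factorial * N.factorial)]
  rw [sub_lt_iff_lt_add', ← hb'] at hy1
  rw [lt_sub_iff_add_lt', ← hb'] at hy2
  refine ⟨b₀ + (N.factorial : ℤ) • y, sim_snoc_iff_of_pos (h.mono hN) ?_ ?_⟩
  · intro c d hc hd0 hd
    obtain ⟨q, hdq, hq⟩ := hdvd d hd0 hd
    have h1 := sign_iff_lt_smul b (b₀ + (N.factorial : ℤ) • y) hdq hq c
    have h2 := hsep c d q hc hd0 hd hdq hq
    rcases (hne c d hc hd0 hd).lt_or_gt with h0 | h0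
    · have h3 := h1.2.2 (hy2.trans (h2.2 h0))
      exact ⟨iff_of_false h0.not_gt h3.not_gt, iff_of_true h0 h3⟩
    · have h3 := h1.1.2 ((h2.1 h0).trans hy1)
      exact ⟨iff_of_true h0 h3, iff_of_false h0.not_gt h3.not_gt⟩
  · intro c d m hc hd hm0 hm
    obtain ⟨q, hdq, hq⟩ := hdvd m (by exact_mod_cast hm0) (by exact_mod_cast hm)
    have h1 : d • (N.factorial : ℤ) • y ∈ multiples B m := by
      rw [hdq, smul_comm, mul_smul]
      exact smul_mem_multiples _ _
    -- Divisibility by m becomes divisibility by N! = m * q after scaling by q.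
    have h2 := hb₀ (q • c) (q * d)
    rw [hdq, mul_comm (m : ℤ), map_smul, map_smul, mul_smul, mul_smul, ← smul_add, ← smul_add,
      smul_mem_multiples_mul hq.ne', smul_mem_multiples_mul hq.ne'] at h2
    rw [h2, smul_add, ← add_assoc, Submodule.add_mem_iff_left _ h1]

/-- The extension step of the Ehrenfeucht–Fraïssé game. -/
theorem Sim.exists_snoc [Nontrivial B] (N : ℕ)
    (h : Sim (2 * N.factorial * N + N.factorial + 2 * N * N + N) a b) (hD : DenseMultiples B)
    (hB : AvoidsCosets B N.factorial) (a' : A) :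
    ∃ b' : B, Sim N (Fin.snoc a a' : Fin (k + 1) → A) (Fin.snoc b b' : Fin (k + 1) → B) := by
  -- In the bound on the similarity, the summand 2N² serves the dependent case, the other three the
  -- independent one.
  by_cases hne : ∀ (c : Fin k → ℤ) (d : ℤ), (∀ i, |c i| ≤ N) → 0 < d → d ≤ N →
      comb a c + d • a' ≠ 0
  · exact h.exists_snoc_of_ne_zero (by omega) (by omega) (by omega) hD hB hne
  · push Not at hne
    obtain ⟨c, d, hc, hd0, hd, h0⟩ := hne
    exact (h.mono (by omega)).exists_snoc_of_eq_zero hc hd0 hd h0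

end

-- Transfer of sentences between rich groups

attribute [local instance] structInv

theorem exists_abs_le {k : ℕ} (c : Fin k → ℤ) : ∃ N : ℕ, ∀ i, |c i| ≤ N :=
  ⟨∑ i, (c i).natAbs, fun i => by
    rw [Int.abs_eq_natAbs]
    exact_mod_cast Finset.single_le_sum (f := fun i => (c i).natAbs) (fun _ _ => Nat.zero_le _)
      (Finset.mem_univ i)⟩

/-- Terms are products of integer powers of their variables. -/
theorem exists_comb_of_term {k : ℕ} (t : Tm k) : ∃ c : Fin k → ℤ, ∀ (G : Type) [CommGroup G]
    [LT G] (a : Fin k → Additive G),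
    Additive.ofMul (t.realize (Sum.elim (default : Empty → G) (Additive.toMul ∘ a))) =
      comb a c := by
  induction t with
  | var v =>
    rcases v with v | i
    · exact v.elim
    · exact ⟨Pi.single i 1, fun G _ _ a => by
        rw [Fintype.linearCombination_apply_single, one_smul]; rfl⟩
  | func f ts ih =>
    choose c hc using ih
    cases f with
    | mul => exact ⟨c 0 + c 1, fun G _ _ a => by rw [map_add, ← hc 0 G a, ← hc 1 G a]; rfl⟩
    | inv => exact ⟨-c 0, fun G _ _ a => by rw [map_neg, ← hc 0 G a]; rfl⟩
    | one => exact ⟨0, fun G _ _ a => by rw [map_zero]; rfl⟩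

/-- The properties of an ordered abelian group that determine the truth of the sentences up to a
complexity measured by `N`. -/
structure Rich (N : ℕ) (G : Type) [CommGroup G] [LinearOrder G] : Prop where
  nontrivial : Nontrivial G
  dense : DenseMultiples (Additive G)
  avoids : AvoidsCosets (Additive G) N

theorem Rich.mono {M N : ℕ} {G : Type} [CommGroup G] [LinearOrder G] (h : Rich N G)
    (hMN : M ≤ N) : Rich M G := ⟨h.1, h.2, h.3.mono hMN⟩

/-- Induction on the formula: atomic formulas are signs of combinations, and a quantifier costs one
back-and-forth step. -/
theorem exists_realize_iff_of_sim {k : ℕ} (φ : Fm k) : ∃ N : ℕ, ∀ (G H : Type)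
    [CommGroup G] [LinearOrder G] [IsOrderedMonoid G]
    [CommGroup H] [LinearOrder H] [IsOrderedMonoid H],
    Rich N G → Rich N H → ∀ (a : Fin k → Additive G) (b : Fin k → Additive H), Sim N a b →
      (φ.Realize (default : Empty → G) (Additive.toMul ∘ a) ↔
        φ.Realize (default : Empty → H) (Additive.toMul ∘ b)) := by
  induction φ with
  | falsum => exact ⟨0, fun _ _ _ _ _ _ _ _ _ _ _ _ _ => Iff.rfl⟩
  | equal t₁ t₂ =>
    obtain ⟨c₁, h₁⟩ := exists_comb_of_term t₁
    obtain ⟨c₂, h₂⟩ := exists_comb_of_term t₂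
    obtain ⟨N, hN⟩ := exists_abs_le (c₁ - c₂)
    refine ⟨N, fun G H _ _ _ _ _ _ _ _ a b h => ?_⟩
    have := h.eq_zero_iff hN
    rw [map_sub, map_sub, sub_eq_zero, sub_eq_zero, ← h₁ G a, ← h₂ G a, ← h₁ H b, ← h₂ H b] at this
    exact this
  | rel R ts =>
    cases R with
    | lt =>
      obtain ⟨c₁, h₁⟩ := exists_comb_of_term (ts 0)
      obtain ⟨c₂, h₂⟩ := exists_comb_of_term (ts 1)
      obtain ⟨N, hN⟩ := exists_abs_le (c₂ - c₁)
      refine ⟨N, fun G H _ _ _ _ _ _ _ _ a b h => ?_⟩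
      have := (h _ hN).1
      rw [map_sub, map_sub, sub_pos, sub_pos, ← h₁ G a, ← h₂ G a, ← h₁ H b, ← h₂ H b] at this
      exact this
  | imp φ₁ φ₂ ih₁ ih₂ =>
    obtain ⟨N₁, h₁⟩ := ih₁
    obtain ⟨N₂, h₂⟩ := ih₂
    refine ⟨max N₁ N₂, fun G H _ _ _ _ _ _ hG hH a b h => ?_⟩
    exact imp_congr
      (h₁ G H (hG.mono (le_max_left _ _)) (hH.mono (le_max_left _ _)) a b
        (h.mono (le_max_left _ _)))
      (h₂ G H (hG.mono (le_max_right _ _)) (hH.mono (le_max_right _ _)) a b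
        (h.mono (le_max_right _ _)))
  | all φ ih =>
    obtain ⟨N, ih⟩ := ih
    have key : ∀ (G H : Type) [CommGroup G] [LinearOrder G] [IsOrderedMonoid G]
        [CommGroup H] [LinearOrder H] [IsOrderedMonoid H],
        Rich (2 * N.factorial * N + N.factorial + 2 * N * N + N) G →
        Rich (2 * N.factorial * N + N.factorial + 2 * N * N + N) H → ∀ a b,
        Sim (A := Additive G) (B := Additive H)
          (2 * N.factorial * N + N.factorial + 2 * N * N + N) a b →
        φ.all.Realize (default : Empty → G) (Additive.toMul ∘ a) →
        φ.all.Realize (default : Empty → H) (Additive.toMul ∘ b) := by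
      intro G H _ _ _ _ _ _ hG hH a b h hφ
      rw [BoundedFormula.realize_all] at hφ ⊢
      intro y
      have := hG.nontrivial
      obtain ⟨z, hz⟩ := Sim.exists_snoc N h.symm hG.dense (hG.avoids.mono (by omega))
        (Additive.ofMul y)
      have h1 := hφ (Additive.toMul z)
      rw [← toMul_ofMul y, ← Fin.comp_snoc]
      rw [← Fin.comp_snoc] at h1
      exact (ih G H (hG.mono (by omega)) (hH.mono (by omega)) _ _ hz.symm).1 h1
    exact ⟨_, fun G H _ _ _ _ _ _ hG hH a b h =>
      ⟨key G H hG hH a b h, key H G hH hG b a h.symm⟩⟩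

/-- Each sentence has the same truth value in all sufficiently rich groups. -/
theorem exists_realize_iff (φ : LInv.Sentence) : ∃ N : ℕ, ∀ (G H : Type)
    [CommGroup G] [LinearOrder G] [IsOrderedMonoid G]
    [CommGroup H] [LinearOrder H] [IsOrderedMonoid H],
    Rich N G → Rich N H → (G ⊨ φ ↔ H ⊨ φ) := by
  obtain ⟨N, h⟩ := exists_realize_iff_of_sim φ
  refine ⟨N, fun G H _ _ _ _ _ _ hG hH => ?_⟩
  -- Empty tuples are similar to every degree, as their only combination is 0.
  have := h G H hG hH default default fun c _ => by
    simp [Fintype.linearCombination_apply]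
  rw [Subsingleton.elim (Additive.toMul ∘ (default : Fin 0 → Additive G)) default,
    Subsingleton.elim (Additive.toMul ∘ (default : Fin 0 → Additive H)) default] at this
  exact this

/-! ### The meaning of the axioms -/

section
variable {G : Type} [CommGroup G] [LinearOrder G]

theorem realize_pow {k : ℕ} (t : Tm k) (v : Empty ⊕ Fin k → G) (n : ℕ) :
    (pow t n).realize v = t.realize v ^ n := by
  induction n using pow.induct with
  | case1 => rw [pow_zero]; rfl
  | case2 => rw [pow_one]; rfl
  | case3 n ih => rw [pow_succ, ← ih]; rfl

theorem realize_M10_iff (n : ℕ) :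
    G ⊨ M10 n ↔ ∀ x z : G, ∃ y, x < z → x < y ^ n ∧ y ^ n < z := by
  simp only [M10, Sentence.Realize, Formula.Realize, BoundedFormula.realize_all,
    BoundedFormula.realize_ex, BoundedFormula.realize_imp, BoundedFormula.realize_inf, lt,
    BoundedFormula.realize_rel₂, realize_pow]
  rfl

theorem realize_M11_iff (n : ℕ) {q : ℕ} (m : Fin q → ℕ) :
    G ⊨ M11 n m ↔ ∀ x : Fin q → G, ∃ y, ∀ z, ∀ j, ¬ m j ∣ n → y ^ n * x j ≠ z ^ m j := by
  rw [M11, Sentence.Realize, BoundedFormula.realize_alls]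
  simp only [BoundedFormula.realize_all, BoundedFormula.realize_ex, BoundedFormula.realize_iInf,
    BoundedFormula.realize_not, eq, BoundedFormula.realize_bdEqual, realize_pow, Subtype.forall]
  refine forall_congr' fun v => exists_congr fun y => forall_congr' fun z => forall_congr' fun j =>
    forall_congr' fun _ => not_congr ?_
  have e₁ : (mul (pow (x (Fin.last q).castSucc) n) (x j.castSucc.castSucc)).realize
      (Sum.elim (default : Empty → G) (Fin.snoc (Fin.snoc v y : Fin (q + 1) → G) z)) =
      y ^ n * v j := by
    change (pow (x (Fin.last q).castSucc) n).realize _ * _ = _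
    rw [realize_pow]
    simp [x]
  have e₂ : (x (Fin.last (q + 1))).realize
      (Sum.elim (default : Empty → G) (Fin.snoc (Fin.snoc v y : Fin (q + 1) → G) z)) = z := by
    simp [x]
  rw [e₁, e₂]

theorem realize_TQRest [IsOrderedMonoid G] [Nontrivial G] (h : DenseMultiples (Additive G)) :
    G ⊨ TQRest := by
  rw [Theory.model_iff]
  rintro φ ((rfl | rfl | rfl | rfl | rfl | rfl | rfl | rfl | rfl) | ⟨n, hn, rfl⟩)
  · intro a b (h : a < b)
    exact h.not_gt
  · intro a b c
    rw [BoundedFormula.realize_imp, BoundedFormula.realize_inf]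
    exact fun ⟨(h₁ : a < b), (h₂ : b < c)⟩ => h₁.trans h₂
  · intro a b
    rw [BoundedFormula.realize_sup, BoundedFormula.realize_sup]
    exact lt_trichotomy a b
  · intro a b c
    exact (mul_assoc a b c).symm
  · intro a
    exact mul_one a
  · intro a
    exact mul_inv_cancel a
  · intro a b
    exact mul_comm a b
  · intro a b c (h : a < b)
    exact mul_lt_mul_left h c
  · obtain ⟨y, hy⟩ := exists_ne (1 : G)
    exact BoundedFormula.realize_ex.2 ⟨y, hy⟩
  · rw [realize_M10_iff]
    intro x z
    by_cases hxz : x < z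
    · obtain ⟨y, hy⟩ := h n hn (Additive.ofMul x) (Additive.ofMul z) hxz
      exact ⟨y.toMul, fun _ => hy⟩
    · exact ⟨1, fun h' => absurd h' hxz⟩

/-- For n = 1 no modulus m_j > 1 divides n, so M11 says that y avoids the cosets of the inverses of
the x_j. -/
theorem avoidsCosets_of_realize_M11 {N : ℕ}
    (h : ∀ (q : ℕ) (m : Fin q → ℕ), (∀ j, 1 < m j ∧ m j ≤ N) → G ⊨ M11 1 m) :
    AvoidsCosets (Additive G) N := by
  intro s hs
  have := (realize_M11_iff 1 _).1 (h s.card (fun j => (s.equivFin.symm j).1.1)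
    fun j => hs _ (s.equivFin.symm j).2) (fun j => ((s.equivFin.symm j).1.2.toMul)⁻¹)
  obtain ⟨y, hy⟩ := this
  refine ⟨Additive.ofMul y, fun e he hmem => ?_⟩
  obtain ⟨z, hz⟩ := mem_multiples.1 hmem
  have h1 := hy z.toMul (s.equivFin ⟨e, he⟩)
  simp only [Equiv.symm_apply_apply] at h1
  refine h1 (fun h2 => (hs e he).1.ne' (Nat.dvd_one.1 h2)) ?_
  rw [pow_one, ← div_eq_mul_inv]
  rw [natCast_zsmul] at hz
  exact hz.symm

end

/-! ### Groups of real numbers with powers in the rationals -/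

theorem exists_prime_padicValRat_eq_zero {ι : Type*} [Fintype ι] (r : ι → ℚ) (hr : ∀ j, r j ≠ 0) :
    ∃ q : ℕ, q.Prime ∧ ∀ j, padicValRat q (r j) = 0 := by
  obtain ⟨q, hq, hqp⟩ := Nat.exists_infinite_primes
    (∑ j, ((r j).num.natAbs + (r j).den) + 1)
  refine ⟨q, hqp, fun j => ?_⟩
  have h1 : (r j).num.natAbs + (r j).den < q := lt_of_lt_of_le (Nat.lt_succ_of_le
    (Finset.single_le_sum (f := fun j => (r j).num.natAbs + (r j).den)
      (fun _ _ => Nat.zero_le _) (Finset.mem_univ j))) hq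
  have h2 := Int.natAbs_ne_zero.2 (Rat.num_ne_zero.2 (hr j))
  have h3 := (r j).den_nz
  rw [padicValRat, padicValInt,
    padicValNat.eq_zero_of_not_dvd (Nat.not_dvd_of_pos_of_lt (by omega) (by omega)),
    padicValNat.eq_zero_of_not_dvd (Nat.not_dvd_of_pos_of_lt (by omega) (by omega))]
  simp

/-- Some power of `a`, with exponent a power of `P`, is rational. -/
def HasRatPow (P : ℕ) (a : ℝ) : Prop := ∃ (K : ℕ) (r : ℚ), a ^ P ^ K = r

/-- Take q prime to numerators and denominators of rational powers of all x_j. Raising the equation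
to a power of P makes it rational, and its q-adic valuation shows that m divides n times a power of
P; m is coprime to P. As q depends only on the x_j, it serves all n and m. -/
theorem exists_prime_pow_mul_ne {ι : Type*} [Fintype ι] {P : ℕ} (hP : P ≠ 0) (x : ι → ℝ)
    (hx0 : ∀ j, x j ≠ 0) (hx : ∀ j, HasRatPow P (x j)) :
    ∃ q : ℕ, q.Prime ∧ ∀ (n m : ℕ) (z : ℝ) (j : ι), HasRatPow P z → z ≠ 0 → m.Coprime P →
      (q : ℝ) ^ n * x j = z ^ m → m ∣ n := by
  choose K r hr using hx
  have hr0 : ∀ j, r j ≠ 0 := fun j h => by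
    have := hr j
    rw [h, Rat.cast_zero] at this
    exact hx0 j (pow_eq_zero_iff (pow_ne_zero _ hP) |>.1 this)
  obtain ⟨q, hq, hqr⟩ := exists_prime_padicValRat_eq_zero r hr0
  refine ⟨q, hq, fun n m z j ⟨L, s, hs⟩ hz0 hm h => ?_⟩
  have := Fact.mk hq
  have hs0 : s ≠ 0 := by
    rintro rfl
    rw [Rat.cast_zero] at hs
    exact hz0 (pow_eq_zero_iff (pow_ne_zero _ hP) |>.1 hs)
  have h1 : ((q : ℝ) ^ n) ^ (P ^ K j * P ^ L) * (r j : ℝ) ^ P ^ L = (s : ℝ) ^ (m * P ^ K j) := by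
    rw [← hr j, ← hs, ← pow_mul (x j), ← mul_pow, h, ← pow_mul, ← pow_mul]
    congr 1
    ring
  have h2 : ((q : ℚ) ^ n) ^ (P ^ K j * P ^ L) * r j ^ P ^ L = s ^ (m * P ^ K j) := by
    exact_mod_cast h1
  have hq0 : (q : ℚ) ≠ 0 := by exact_mod_cast hq.ne_zero
  have h3 := congrArg (padicValRat q) h2
  rw [padicValRat.mul (pow_ne_zero _ (pow_ne_zero _ hq0)) (pow_ne_zero _ (hr0 j)),
    padicValRat.pow, padicValRat.pow, padicValRat.pow, hqr,
    padicValRat.pow, padicValRat.self hq.one_lt] at h3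
  have h4 : (m : ℤ) ∣ ((P ^ K j * P ^ L * n : ℕ) : ℤ) :=
    ⟨P ^ K j * padicValRat q s, by push_cast at h3 ⊢; linarith⟩
  rw [Int.natCast_dvd_natCast] at h4
  exact (Nat.Coprime.mul_right (hm.pow_right _) (hm.pow_right _)).dvd_of_dvd_mul_left h4

/-! ### The positive rational numbers -/

theorem PosRat.nontrivial : Nontrivial PosRat :=
  ⟨⟨1, ⟨2, two_pos⟩, fun h => by simpa using congrArg Subtype.val h⟩⟩

theorem PosRat.denseMultiples : DenseMultiples (Additive PosRat) := by
  intro n hn x z hxz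
  obtain ⟨y, hy0, h1, h2⟩ := exists_rat_pow_btwn hn.ne'
    (show (x.toMul : ℚ) < (z.toMul : ℚ) from hxz) z.toMul.2
  exact ⟨Additive.ofMul ⟨y, hy0⟩, h1, h2⟩

theorem PosRat.realize_M11 (n : ℕ) {q : ℕ} (m : Fin q → ℕ) : PosRat ⊨ M11 n m := by
  refine (realize_M11_iff n m).2 fun x => ?_
  have hrat : ∀ a : PosRat, HasRatPow 1 ((a : ℚ) : ℝ) := fun a => ⟨0, a, by simp⟩
  have h0 : ∀ a : PosRat, ((a : ℚ) : ℝ) ≠ 0 := fun a => by exact_mod_cast a.2.ne'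
  obtain ⟨p, hp, h⟩ := exists_prime_pow_mul_ne one_ne_zero (fun j => ((x j : ℚ) : ℝ))
    (fun j => h0 _) fun j => hrat _
  refine ⟨⟨p, by exact_mod_cast hp.pos⟩, fun z j hj he => hj (h n (m j) ((z : ℚ) : ℝ) j (hrat z)
    (h0 z) (Nat.coprime_one_right _) ?_)⟩
  have := congrArg (fun a : PosRat => ((a : ℚ) : ℝ)) he
  simpa using this

theorem PosRat.rich (N : ℕ) : Rich N PosRat :=
  ⟨PosRat.nontrivial, PosRat.denseMultiples,
    avoidsCosets_of_realize_M11 fun _ m _ => PosRat.realize_M11 1 m⟩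

/-! ### The groups of products of primes with exponents in `ℤ[1/p]` -/

theorem zInv_div {p : ℕ} {r : ℚ} (hr : r ∈ zInv p) : r / p ∈ zInv p := by
  obtain ⟨m, k, rfl⟩ := hr
  exact ⟨m, k + 1, by rw [pow_succ, div_div]⟩

section
variable {p : ℕ} [hp : Fact p.Prime]

theorem primeProd_mem {l : ℕ} {r : ℕ → ℚ} (hr : ∀ i, r i ∈ zInv p)
    (h0 : 0 < primeProd l r) : (⟨primeProd l r, h0⟩ : PosReal) ∈ primeRoots p :=
  ⟨l, r, hr, rfl⟩

theorem primeProd_pos (l : ℕ) (r : ℕ → ℚ) : 0 < primeProd l r :=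
  Finset.prod_pos fun i _ => Real.rpow_pos_of_pos (prime_pos i) _

theorem exists_pow_eq (y : primeRoots p) : ∃ z : primeRoots p, z ^ p = y := by
  obtain ⟨⟨y, hy0⟩, l, r, hr, rfl : y = _⟩ := y
  refine ⟨⟨⟨_, primeProd_pos l fun i => r i / p⟩, primeProd_mem (fun i => zInv_div (hr i)) _⟩, ?_⟩
  have hp0 : (p : ℝ) ≠ 0 := by exact_mod_cast hp.out.ne_zero
  refine Subtype.ext (Subtype.ext ?_)
  change primeProd l (fun i => r i / p) ^ p = primeProd l r
  rw [primeProd, ← Finset.prod_pow]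
  refine Finset.prod_congr rfl fun i _ => ?_
  rw [← Real.rpow_mul_natCast (prime_pos i).le]
  push_cast
  rw [div_mul_cancel₀ _ hp0]

/-- A common power of p clears the denominators of the finitely many exponents. -/
theorem hasRatPow_of_mem (a : primeRoots p) : HasRatPow p (a.1 : ℝ) := by
  obtain ⟨a, l, r, hr, ha⟩ := a
  change HasRatPow p (a : ℝ)
  rw [ha]
  clear ha
  induction l with
  | zero => exact ⟨0, 1, by simp [primeProd]⟩
  | succ l ih =>
    obtain ⟨K, s, hs⟩ := ih
    obtain ⟨m, k, hm⟩ := hr l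
    have hp0 : (p : ℝ) ^ k ≠ 0 := pow_ne_zero _ (by exact_mod_cast hp.out.ne_zero)
    refine ⟨K + k, s ^ p ^ k * ((Nat.nth Nat.Prime l : ℚ) ^ m) ^ p ^ K, ?_⟩
    have h1 : ((Nat.nth Nat.Prime l : ℝ) ^ (r l : ℝ)) ^ p ^ k = (Nat.nth Nat.Prime l : ℝ) ^ m := by
      rw [← Real.rpow_mul_natCast (prime_pos l).le, hm]
      push_cast
      rw [div_mul_cancel₀ _ hp0, Real.rpow_intCast]
    rw [primeProd, Finset.prod_range_succ, mul_pow, pow_add, pow_mul]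
    nth_rw 2 [mul_comm]
    rw [pow_mul, h1]
    push_cast
    rw [← hs]
    rfl

theorem natCast_prime_mem {q : ℕ} (hq : q.Prime) :
    (⟨q, by exact_mod_cast hq.pos⟩ : PosReal) ∈ primeRoots p := by
  refine ⟨Nat.count Nat.Prime q + 1, fun i => if i = Nat.count Nat.Prime q then 1 else 0,
    fun i => ?_, ?_⟩
  · dsimp only
    split_ifs
    · exact ⟨1, 0, by simp⟩
    · exact zInv_zero p
  · rw [primeProd, Finset.prod_range_succ, Finset.prod_eq_one, Nat.nth_count hq]
    · simp
    · intro i hi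
      simp [(Finset.mem_range.1 hi).ne]

theorem primeRoots.nontrivial : Nontrivial (primeRoots p) :=
  ⟨⟨1, ⟨_, natCast_prime_mem hp.out⟩, fun h => by
    have : (1 : ℝ) = p := congrArg (fun a : primeRoots p => (a.1 : ℝ)) h
    exact hp.out.one_lt.ne (by exact_mod_cast this)⟩⟩

theorem exists_pow_pow_eq (y : primeRoots p) (k : ℕ) : ∃ z : primeRoots p, z ^ p ^ k = y := by
  induction k with
  | zero => exact ⟨y, by simp⟩
  | succ k ih =>
    obtain ⟨z, hz⟩ := ih
    obtain ⟨w, hw⟩ := exists_pow_eq z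
    exact ⟨w, by rw [pow_succ', pow_mul, hw, hz]⟩

theorem primeRoots.denseMultiples : DenseMultiples (Additive (primeRoots p)) := by
  intro n hn x z hxz
  let b : primeRoots p := ⟨_, natCast_prime_mem Nat.prime_two⟩
  have hx0 : (0 : ℝ) < x.toMul.1 := x.toMul.1.2
  have hw : (1 : ℝ) < (z.toMul.1 : ℝ) / x.toMul.1 := (one_lt_div hx0).2 hxz
  -- For this k, the p^k-th root g of 2 satisfies g^n < z / x, because k < p^k. The powers of g^n
  -- then cannot jump over the interval from x to z.
  obtain ⟨k, hk⟩ := pow_unbounded_of_one_lt ((2 : ℝ) ^ n) hw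
  obtain ⟨g, hg⟩ := exists_pow_pow_eq b k
  have hg0 : (0 : ℝ) < g.1 := g.1.2
  have hg' : (g.1 : ℝ) ^ p ^ k = 2 := congrArg (fun a : primeRoots p => (a.1 : ℝ)) hg
  have hpk : p ^ k ≠ 0 := pow_ne_zero _ hp.out.ne_zero
  have hg1 : (1 : ℝ) < g.1 := by
    refine lt_of_pow_lt_pow_left₀ (p ^ k) hg0.le ?_
    rw [hg', one_pow]
    norm_num
  have hgn : (g.1 : ℝ) ^ n < (z.toMul.1 : ℝ) / x.toMul.1 := by
    refine lt_of_pow_lt_pow_left₀ (p ^ k) (zero_lt_one.trans hw).le ?_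
    rw [pow_right_comm, hg']
    exact hk.trans_le (pow_le_pow_right₀ hw.le (Nat.lt_pow_self hp.out.one_lt).le)
  obtain ⟨t, ht1, ht2⟩ := exists_mem_Ico_zpow hx0 (one_lt_pow₀ hg1 hn.ne')
  refine ⟨Additive.ofMul (g ^ (t + 1)), ?_⟩
  have e : ((((g ^ (t + 1)) ^ n : primeRoots p).1 : PosReal) : ℝ) = ((g.1 : ℝ) ^ n) ^ (t + 1) := by
    rw [← zpow_natCast, ← zpow_natCast, ← zpow_mul, ← zpow_mul, mul_comm]
    rfl
  constructor
  · change (x.toMul.1 : ℝ) < (((g ^ (t + 1)) ^ n : primeRoots p).1 : PosReal)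
    rw [e]
    exact ht2
  · change ((((g ^ (t + 1)) ^ n : primeRoots p).1 : PosReal) : ℝ) < z.toMul.1
    rw [e, zpow_add_one₀ (pow_pos hg0 n).ne']
    rw [lt_div_iff₀ hx0] at hgn
    nlinarith [pow_pos hg0 n]

theorem primeRoots.realize_M11 (n : ℕ) {q : ℕ} (m : Fin q → ℕ) (hm : ∀ j, 1 < m j ∧ m j < p) :
    primeRoots p ⊨ M11 n m := by
  refine (realize_M11_iff n m).2 fun x => ?_
  have h0 : ∀ a : primeRoots p, (a.1 : ℝ) ≠ 0 := fun a => a.1.2.ne'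
  obtain ⟨l, hl, h⟩ := exists_prime_pow_mul_ne hp.out.ne_zero (fun j => ((x j).1 : ℝ))
    (fun j => h0 _) fun j => hasRatPow_of_mem _
  refine ⟨⟨_, natCast_prime_mem hl⟩, fun z j hj he => hj (h n (m j) (z.1 : ℝ) j
    (hasRatPow_of_mem z) (h0 z) ?_ ?_)⟩
  · exact ((Nat.Prime.coprime_iff_not_dvd hp.out).2
      (Nat.not_dvd_of_pos_of_lt (by have := hm j; omega) (hm j).2)).symm
  · exact congrArg (fun a : primeRoots p => (a.1 : ℝ)) he

theorem primeRoots.not_realize_M11 : ¬ (primeRoots p ⊨ M11 1 ![p]) := by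
  intro h
  obtain ⟨y, hy⟩ := (realize_M11_iff 1 ![p]).1 h fun _ => 1
  obtain ⟨z, hz⟩ := exists_pow_eq y
  refine hy z 0 (fun h => hp.out.one_lt.ne' (Nat.dvd_one.1 h)) ?_
  rw [pow_one, mul_one]
  exact hz.symm

theorem primeRoots.rich {N : ℕ} (hN : N < p) : Rich N (primeRoots p) :=
  ⟨primeRoots.nontrivial, primeRoots.denseMultiples, avoidsCosets_of_realize_M11 fun _ m hm =>
    primeRoots.realize_M11 1 m fun j => ⟨(hm j).1, (hm j).2.trans_lt hN⟩⟩

theorem primeRoots.realize_TQRest : primeRoots p ⊨ TQRest :=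
  have := primeRoots.nontrivial (p := p)
  OrdMul.realize_TQRest primeRoots.denseMultiples

end

-- The language `{<, ×}` and the failure of finite axiomatizability

attribute [local instance] structMul

/-- The inclusion of the language `{<, ×}` in `{<, ×, ⁻¹, 1}`. -/
def inclusion : LMul →ᴸ LInv where
  onFunction := fun {_} f => match f with
    | Func.mul => FuncInv.mul
  onRelation := fun {_} R => R

instance inclusion_isExpansionOn (G : Type) [Mul G] [Inv G] [One G] [LT G] :
    inclusion.IsExpansionOn G where
  map_onFunction := fun f _ => by cases f; rfl
  map_onRelation := fun R _ => by cases R; rfl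

/-- The term `tⁿ⁺¹` of the language `{<, ×}`. -/
def powSucc {k : ℕ} (t : LMul.Term (Empty ⊕ Fin k)) : ℕ → LMul.Term (Empty ⊕ Fin k)
  | 0 => t
  | n + 1 => Term.func (Func.mul : LMul.Functions 2) ![powSucc t n, t]

theorem realize_powSucc {G : Type} [CommGroup G] [LT G] {k : ℕ} (t : LMul.Term (Empty ⊕ Fin k))
    (v : Empty ⊕ Fin k → G) (n : ℕ) : (powSucc t n).realize v = t.realize v ^ (n + 1) := by
  induction n with
  | zero => rw [zero_add, pow_one]; rfl
  | succ n ih => rw [pow_succ, ← ih]; rfl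

/-- Some element is not an `n + 1`-st power. -/
def existsNotPow (n : ℕ) : LMul.Sentence :=
  BoundedFormula.ex <| BoundedFormula.all (n := 1) <| BoundedFormula.not <|
    Term.bdEqual (Term.var (Sum.inr 0)) (powSucc (Term.var (Sum.inr 1)) n)

theorem realize_existsNotPow {G : Type} [CommGroup G] [LT G] (n : ℕ) :
    G ⊨ existsNotPow n ↔ ∃ y : G, ∀ z, y ≠ z ^ (n + 1) := by
  simp only [existsNotPow, Sentence.Realize, Formula.Realize, BoundedFormula.realize_all,
    BoundedFormula.realize_ex, BoundedFormula.realize_not, BoundedFormula.realize_bdEqual,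
    realize_powSucc]
  rfl

theorem realize_existsNotPow_of_M11 {G : Type} [CommGroup G] [LinearOrder G] {n : ℕ} (hn : n ≠ 0)
    (h : G ⊨ M11 1 ![n + 1]) : G ⊨ existsNotPow n := by
  obtain ⟨y, hy⟩ := (realize_M11_iff 1 _).1 h fun _ => 1
  refine (realize_existsNotPow n).2 ⟨y, fun z hz => hy z 0 (fun h => ?_) ?_⟩
  · exact hn (by simpa using h)
  · rw [pow_one, mul_one]
    exact hz

theorem not_realize_existsNotPow {p n : ℕ} [Fact p.Prime] (hn : n + 1 = p) :
    ¬ (primeRoots p ⊨ existsNotPow n) := by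
  intro h
  obtain ⟨y, hy⟩ := (realize_existsNotPow n).1 h
  obtain ⟨z, hz⟩ := exists_pow_eq y
  exact hy z (by rw [hn, hz])

/-- Each sentence that holds in the positive rationals holds in the groups with exponents in
`ℤ[1/p]` for all large `p`. -/
theorem eventually_primeRoots_realize {φ : LInv.Sentence} (h : PosRat ⊨ φ) :
    ∀ᶠ p in Filter.atTop, ∀ [Fact p.Prime], primeRoots p ⊨ φ := by
  obtain ⟨N, hN⟩ := exists_realize_iff φ
  filter_upwards [Filter.eventually_gt_atTop N] with p hp _
  exact (hN PosRat (primeRoots p) (PosRat.rich N) (primeRoots.rich hp)).1 h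

theorem eventually_primeRoots_realize_mul {φ : LMul.Sentence} (h : PosRat ⊨ φ) :
    ∀ᶠ p in Filter.atTop, ∀ [Fact p.Prime], primeRoots p ⊨ φ := by
  filter_upwards [eventually_primeRoots_realize
    ((inclusion.realize_onSentence PosRat φ).2 h)] with p hp _
  exact (inclusion.realize_onSentence (primeRoots p) φ).1 hp

theorem exists_prime_of_eventually {P : ℕ → Prop} (h : ∀ᶠ p in Filter.atTop, P p) :
    ∃ p, p.Prime ∧ P p := by
  obtain ⟨N, hN⟩ := Filter.eventually_atTop.1 h
  obtain ⟨p, hp, hpp⟩ := Nat.exists_infinite_primes N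
  exact ⟨p, hpp, hN p hp⟩

/-- If each true sentence holds in almost all structures of a family, but each of these structures
fails to satisfy some true sentence, then the complete theory is not finitely axiomatizable. -/
theorem not_finitelyAxiomatizable {L : FirstOrder.Language.{0, 0}} {M : Type} [L.Structure M]
    (S : ∀ p : ℕ, [Fact p.Prime] → Type) [∀ (p : ℕ) [Fact p.Prime], L.Structure (S p)]
    [∀ (p : ℕ) [Fact p.Prime], Nonempty (S p)]
    (h₁ : ∀ φ : L.Sentence, M ⊨ φ → ∀ᶠ p in Filter.atTop, ∀ [Fact p.Prime], S p ⊨ φ)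
    (h₂ : ∀ (p : ℕ) [Fact p.Prime], ∃ φ : L.Sentence, M ⊨ φ ∧ ¬ (S p ⊨ φ)) [Nonempty M] :
    ¬ FinitelyAxiomatizable (L.completeTheory M) := by
  rintro ⟨F, hF, hFT⟩
  have hev : ∀ᶠ p in Filter.atTop, ∀ φ ∈ F, ∀ [Fact p.Prime], S p ⊨ φ :=
    (Filter.eventually_all_finite hF).2 fun φ hφ => h₁ φ <|
      ((hFT φ).1 (Theory.models_sentence_of_mem hφ)).realize_sentence M
  obtain ⟨p, hp, hpF⟩ := exists_prime_of_eventually hev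
  have := Fact.mk hp
  obtain ⟨φ, hφ, hnφ⟩ := h₂ p
  have : S p ⊨ F := F.model_iff.2 fun ψ hψ => hpF ψ hψ
  exact hnφ (((hFT φ).2 (Theory.models_sentence_of_mem hφ)).realize_sentence (S p))

theorem eventually_primeRoots_realize_of_mem {φ : LInv.Sentence} (hφ : φ ∈ TQ) :
    ∀ᶠ p in Filter.atTop, ∀ [Fact p.Prime], primeRoots p ⊨ φ := by
  rcases hφ with hφ | ⟨n, q, m, -, hm, rfl⟩
  · exact Filter.Eventually.of_forall fun p _ =>
      primeRoots.realize_TQRest.realize_of_mem φ hφ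
  -- Beyond the sum of the moduli, p exceeds each of them.
  · filter_upwards [Filter.eventually_gt_atTop (∑ j, m j)] with p hp _
    exact primeRoots.realize_M11 n m fun j => ⟨hm j,
      (Finset.single_le_sum (fun _ _ => Nat.zero_le _) (Finset.mem_univ j)).trans_lt hp⟩

theorem eventually_primeRoots_model {F : LInv.Theory} (hF : F ⊆ TQ) (hfin : F.Finite) :
    ∀ᶠ p in Filter.atTop, ∀ [Fact p.Prime], primeRoots p ⊨ F := by
  filter_upwards [(Filter.eventually_all_finite hfin).2 fun φ hφ =>
    eventually_primeRoots_realize_of_mem (hF hφ)] with p hp _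
  exact F.model_iff.2 fun φ hφ => hp φ hφ

theorem M11_mem_scheme {p : ℕ} (hp : p.Prime) : M11 1 ![p] ∈ M11Scheme :=
  ⟨1, 1, ![p], le_rfl, fun j => by simpa using hp.one_lt, rfl⟩

end OrdMul

theorem mainTheorem3 :
    -- the theory of the ordered multiplicative positive rationals is not finitely axiomatizable,
    -- neither in the language `{<, ×}` nor in the language `{<, ×, ⁻¹, 1}`
    ¬ OrdMul.FinitelyAxiomatizable (OrdMul.LMul.completeTheory OrdMul.PosRat) ∧
    ¬ OrdMul.FinitelyAxiomatizable (OrdMul.LInv.completeTheory OrdMul.PosRat) ∧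
    -- the axioms that hold in the group of products of primes with exponents in `ℤ[1/p]`
    (∀ (p : ℕ) [Fact p.Prime],
      OrdMul.primeRoots p ⊨ OrdMul.TQRest ∧
      (∀ (n q : ℕ) (m : Fin q → ℕ), 1 ≤ n → (∀ j, 1 < m j ∧ m j < p) →
        OrdMul.primeRoots p ⊨ OrdMul.M11 n m) ∧
      ¬ (OrdMul.primeRoots p ⊨ OrdMul.M11 1 ![p])) ∧
    -- any finitely many axioms of `TQ` hold in these groups for all large `p`, but not all of `TQ`
    (∀ F : OrdMul.LInv.Theory, F ⊆ OrdMul.TQ → F.Finite →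
      ∃ N : ℕ, ∀ (p : ℕ) [Fact p.Prime], N ≤ p →
        OrdMul.primeRoots p ⊨ F ∧ ¬ (OrdMul.primeRoots p ⊨ OrdMul.TQ)) ∧
    -- finitely many instances of `M11`, with the other axioms, do not prove all its instances
    (∀ F : OrdMul.LInv.Theory, F ⊆ OrdMul.M11Scheme → F.Finite →
      ∃ φ ∈ OrdMul.M11Scheme, ¬ (OrdMul.TQRest ∪ F) ⊨ᵇ φ) := by
  refine ⟨?_, ?_, fun p hp => ⟨OrdMul.primeRoots.realize_TQRest,
    fun n q m _ hm => OrdMul.primeRoots.realize_M11 n m hm, OrdMul.primeRoots.not_realize_M11⟩,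
    fun F hF hfin => ?_, fun F hF hfin => ?_⟩
  · let _ := fun (p : ℕ) [Fact p.Prime] => OrdMul.structMul (OrdMul.primeRoots p)
    refine OrdMul.not_finitelyAxiomatizable (fun p _ => OrdMul.primeRoots p)
      (fun φ h => OrdMul.eventually_primeRoots_realize_mul h) fun p hp => ?_
    -- The separating sentence, some element is not a p-th power, has index p - 1 because exponents
    -- are shifted by one.
    have hp1 : p - 1 + 1 = p := Nat.sub_add_cancel hp.out.one_le
    exact ⟨OrdMul.existsNotPow (p - 1),
      OrdMul.realize_existsNotPow_of_M11 (Nat.sub_ne_zero_of_lt hp.out.one_lt)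
        (OrdMul.PosRat.realize_M11 1 _), OrdMul.not_realize_existsNotPow hp1⟩
  · exact OrdMul.not_finitelyAxiomatizable (fun p _ => OrdMul.primeRoots p)
      (fun φ h => OrdMul.eventually_primeRoots_realize h)
      fun p hp => ⟨_, OrdMul.PosRat.realize_M11 1 ![p], OrdMul.primeRoots.not_realize_M11⟩
  · obtain ⟨N, hN⟩ := Filter.eventually_atTop.1 (OrdMul.eventually_primeRoots_model hF hfin)
    exact ⟨N, fun p hp hNp => ⟨hN p hNp, fun h => OrdMul.primeRoots.not_realize_M11
      (h.realize_of_mem _ (Or.inr (OrdMul.M11_mem_scheme hp.out)))⟩⟩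
  · obtain ⟨p, hp, hpF⟩ := OrdMul.exists_prime_of_eventually
      (OrdMul.eventually_primeRoots_model (hF.trans Set.subset_union_right) hfin)
    have := Fact.mk hp
    refine ⟨_, OrdMul.M11_mem_scheme hp, fun h => OrdMul.primeRoots.not_realize_M11 (p := p) ?_⟩
    have : OrdMul.primeRoots p ⊨ OrdMul.TQRest ∪ F :=
      OrdMul.primeRoots.realize_TQRest.union hpF
    exact h.realize_sentence (OrdMul.primeRoots p)
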